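/- Let $\mathbb{K}$ be $\mathbb{R}$ or $\mathbb{C}$. A C*-algebra over $\mathbb{K}$ is a (not necessarily unital) Banach $*$-algebra over $\mathbb{K}$ that is isometrically $*$-isomorphic to a norm-closed $*$-subalgebra of $B(\mathcal H)$ for some Hilbert space $\mathcal H$ over $\mathbb{K}$. A presentation $A^\dagger=(A,\vec a)$ of a C*-algebra $A$ over $\mathbb{K}$ is a sequence $\vec a$ of elements of $A$, of length $|\vec a|\in\mathbb{N}\cup\{\omega\}$, that generates $A$ as a C*-algebra over $\mathbb{K}$. A rational point of $A^\dagger$ is an element $r(\vec a)$, where $r$ is a noncommutative $*$-polynomial without constant term whose coefficients lie in $\mathbb{Q}$ (if $\mathbb{K}=\mathbb{R}$) or in $\mathbb{Q}(i)$ (if $\mathbb{K}=\mathbb{C}$); it is given to an algorithm by a code of such a polynomial $r$. The presentation $A^\dagger$ is computable if there is an algorithm that, given a rational point $r(\vec a)$ and $k\in\mathbb{N}$, returns $q\in\mathbb{Q}$ with $\bigl|\,\|r(\vec a)\|-q\,\bigr|<2^{-k}$. An open (closed) rational ball of $A^\dagger$ is an open (closed) ball whose center is a rational point and whose radius is a positive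 dyadic rational. A closed set $S\subseteq A$ is c.e. closed if the set of (codes of) open rational balls that intersect $S$ is computably enumerable, strongly co-c.e. closed if the set of (codes of) closed rational balls that do not intersect $S$ is computably enumerable, and strongly computable closed if it is both. For $n\in\mathbb{N}\cup\{\omega\}$, the universal contraction C*-algebra $C_{\mathbb{K}}(n)$ is the universal C*-algebra over $\mathbb{K}$ on a sequence $\vec c$ of $n$ generators subject to $\|c_j\|\le 1$ for all $j$; its standard presentation is $(C_{\mathbb{K}}(n),\vec c)$. If $A^\dagger=(A,\vec a)$ is a presentation with $\|a_j\|\le 1$ for all $j$, the word problem of $A^\dagger$ is the kernel of the $*$-homomorphism $C_{\mathbb{K}}(|\vec a|)\to A$ with $c_j\mapsto a_j$. **Theorem.** Let $A$ be a C*-algebra over $\mathbb{K}$ with a presentation $A^\dagger=(A,\vec a)$ such that $\|a_j\|\le 1$ for all $j$. Then $A^\dagger$ is computable if and only if the word problem of $A^\dagger$ is a strongly computable closed subset of $C_{\mathbb{K}}(|\vec a|)$ with respect to its standard presentation. -/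

import Mathlib

open scoped ENNReal

universe u

/-- A C⋆-algebra over `𝕜` (`ℝ` or `ℂ`): a Banach `*`-algebra over `𝕜`, not necessarily unital, that
is isometrically `*`-isomorphic to a norm-closed `*`-subalgebra of the bounded operators on a
Hilbert space over `𝕜`. (The image of an isometric `*`-homomorphism defined on a complete space is
automatically norm-closed.) -/
class CStarAlgebraOver (𝕜 : Type) [RCLike 𝕜] (A : Type u) [NonUnitalNormedRing A] [StarRing A]
    [NormedSpace 𝕜 A] [IsScalarTower 𝕜 A A] [SMulCommClass 𝕜 A A] [StarModule 𝕜 A] : Prop where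
  complete : CompleteSpace A
  exists_isometric_rep : ∃ (H : Type u) (_ : NormedAddCommGroup H) (_ : InnerProductSpace 𝕜 H)
    (_ : CompleteSpace H) (φ : A →⋆ₙₐ[𝕜] (H →L[𝕜] H)), Isometry φ

/-! ### Rational points -/

/-- Names of rational numbers: `(a, b, c)` names `(a - b) / (c + 1)`. -/
abbrev RatCode : Type := ℕ × ℕ × ℕ

/-- The rational number named by a code. -/
def RatCode.val (q : RatCode) : ℚ := ((q.1 : ℚ) - (q.2.1 : ℚ)) / ((q.2.2 : ℚ) + 1)

/-- Names of positive dyadic rationals: `(m, k)` names `(m + 1) / 2 ^ k`. -/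
abbrev DyadicCode : Type := ℕ × ℕ

/-- The positive dyadic rational named by a code. -/
noncomputable def DyadicCode.val (d : DyadicCode) : ℝ := ((d.1 : ℝ) + 1) / 2 ^ d.2

/-- A letter is a generator `x i`, coded `(i, false)`, or its adjoint, coded `(i, true)`. -/
abbrev LetterCode (ι : Type) : Type := ι × Bool

/-- A nonempty word: first letter and list of the remaining letters. -/
abbrev WordCode (ι : Type) : Type := LetterCode ι × List (LetterCode ι)

/-- Names of rational noncommutative `*`-polynomials without constant term: lists of monomials,
each with a coefficient `s + t i`, given by names of the rationals `s`, `t`, and a nonempty word. -/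
abbrev PolyCode (ι : Type) : Type := List ((RatCode × RatCode) × WordCode ι)

section Eval

variable {ι : Type} {A : Type*} [NonUnitalNormedRing A] [StarRing A]

/-- Value of a letter at a family of elements. -/
def LetterCode.eval (a : ι → A) (l : LetterCode ι) : A := if l.2 then star (a l.1) else a l.1

/-- Value of a nonempty word at a family of elements. -/
def WordCode.eval (a : ι → A) (w : WordCode ι) : A :=
  w.2.foldl (fun x l => x * LetterCode.eval a l) (LetterCode.eval a w.1)

/-- The scalar `s + t i`. For `𝕜 = ℝ` one has `RCLike.I = 0`, so that this is just `s`. -/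
noncomputable def coeffVal (𝕜 : Type*) [RCLike 𝕜] (z : RatCode × RatCode) : 𝕜 :=
  ((RatCode.val z.1 : ℚ) : 𝕜) + ((RatCode.val z.2 : ℚ) : 𝕜) * RCLike.I

/-- Value of a rational `*`-polynomial at a family of elements. -/
noncomputable def PolyCode.eval (𝕜 : Type*) [RCLike 𝕜] [NormedSpace 𝕜 A] (a : ι → A)
    (p : PolyCode ι) : A :=
  (p.map fun m => coeffVal 𝕜 m.1 • WordCode.eval a m.2).sum

end Eval

/-! ### Presentations -/

/-- The index set of a sequence of length `n`, where `n` is finite or infinite. -/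
def SeqIndex : ℕ∞ → Type
  | some n => Fin n
  | none => ℕ

instance SeqIndex.instPrimcodable : (n : ℕ∞) → Primcodable (SeqIndex n)
  | some n => (Primcodable.fin : Primcodable (Fin n))
  | none => (Primcodable.ofDenumerable ℕ : Primcodable ℕ)

/-- A presentation of `A`: a finite or infinite sequence of elements of `A` that generates `A` as a
C⋆-algebra over `𝕜`. -/
structure CStarPresentation (𝕜 : Type) [RCLike 𝕜] (A : Type u) [NonUnitalNormedRing A]
    [StarRing A] [NormedSpace 𝕜 A] [IsScalarTower 𝕜 A A] [SMulCommClass 𝕜 A A]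
    [StarModule 𝕜 A] where
  length : ℕ∞
  point : SeqIndex length → A
  generates : Dense (NonUnitalStarAlgebra.adjoin 𝕜 (Set.range point) : Set A)

namespace CStarPresentation

variable {𝕜 : Type} [RCLike 𝕜] {A : Type u} [NonUnitalNormedRing A] [StarRing A]
  [NormedSpace 𝕜 A] [IsScalarTower 𝕜 A A] [SMulCommClass 𝕜 A A] [StarModule 𝕜 A]

/-- The rational point with a given name. -/
noncomputable def ratPoint (P : CStarPresentation 𝕜 A) (p : PolyCode (SeqIndex P.length)) : A :=
  PolyCode.eval 𝕜 P.point p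

/-- A presentation is computable if norms of rational points can be computed to any precision. -/
def IsComputable (P : CStarPresentation 𝕜 A) : Prop :=
  ∃ f : PolyCode (SeqIndex P.length) × ℕ → RatCode, Computable f ∧
    ∀ p k, |‖P.ratPoint p‖ - ((RatCode.val (f (p, k)) : ℚ) : ℝ)| < ((2 : ℝ) ^ k)⁻¹

/-- `S` is closed, and the set of all open rational balls that intersect `S` is c.e. -/
def IsCEClosed (P : CStarPresentation 𝕜 A) (S : Set A) : Prop :=
  IsClosed S ∧ REPred fun b : PolyCode (SeqIndex P.length) × DyadicCode =>
    (Metric.ball (P.ratPoint b.1) (DyadicCode.val b.2) ∩ S).Nonempty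

/-- `S` is closed, and the set of all closed rational balls that do not intersect `S` is c.e. -/
def IsStronglyCoCEClosed (P : CStarPresentation 𝕜 A) (S : Set A) : Prop :=
  IsClosed S ∧ REPred fun b : PolyCode (SeqIndex P.length) × DyadicCode =>
    Metric.closedBall (P.ratPoint b.1) (DyadicCode.val b.2) ∩ S = ∅

/-- `S` is c.e. closed and strongly co-c.e. closed. -/
def IsStronglyComputableClosed (P : CStarPresentation 𝕜 A) (S : Set A) : Prop :=
  P.IsCEClosed S ∧ P.IsStronglyCoCEClosed S

end CStarPresentation

/-! ### Helper facts on `*`-homomorphisms and Hilbert sums -/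

/-- In a Banach `*`-algebra with isometric involution, a self-adjoint `x` with `‖x‖ < 1` can be
written as `2 y - y ^ 2` with `y` self-adjoint. -/
theorem exists_selfAdjoint_two_sub_sq {X : Type*} {𝕜 : Type*} [RCLike 𝕜] [NonUnitalNormedRing X]
    [StarRing X] [NormedStarGroup X] [NormedSpace 𝕜 X] [IsScalarTower 𝕜 X X] [SMulCommClass 𝕜 X X]
    [StarModule 𝕜 X] [CompleteSpace X] (x : X) (hx : star x = x) (hx1 : ‖x‖ < 1) :
    ∃ y : X, star y = y ∧ x = y + y - y * y := by
  set ρ : ℝ := 1 - Real.sqrt (1 - ‖x‖) with hρ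
  have hs0 : 0 < Real.sqrt (1 - ‖x‖) := Real.sqrt_pos.2 (by linarith)
  have hs1 : Real.sqrt (1 - ‖x‖) ≤ 1 := Real.sqrt_le_one.2 (by linarith [norm_nonneg x])
  have hsq : Real.sqrt (1 - ‖x‖) ^ 2 = 1 - ‖x‖ := Real.sq_sqrt (by linarith)
  have hρ0 : 0 ≤ ρ := by linarith
  have hρ1 : ρ < 1 := by linarith
  have hρe : ‖x‖ + ρ * ρ = 2 * ρ := by rw [hρ]; nlinarith
  let S : Set X := {y | ‖y‖ ≤ ρ ∧ star y = y}
  have hScl : IsClosed S :=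
    (isClosed_le continuous_norm continuous_const).inter
      (isClosed_eq continuous_star continuous_id)
  let h : 𝕜 := (2 : 𝕜)⁻¹
  have hh : ‖h‖ = 2⁻¹ := by simp [h]
  let F : X → X := fun y => h • (x + y * y)
  have hmaps : Set.MapsTo F S S := by
    rintro y ⟨hy, hys⟩
    refine ⟨?_, ?_⟩
    · have h1 : ‖x + y * y‖ ≤ ‖x‖ + ρ * ρ :=
        (norm_add_le _ _).trans (add_le_add le_rfl ((norm_mul_le _ _).trans (by gcongr)))
      simp only [F]
      rw [norm_smul, hh]
      linarith
    · simp [F, star_smul, h, hx, hys]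
  have hcontr : ContractingWith ⟨ρ, hρ0⟩ (hmaps.restrict F S S) := by
    refine ⟨by exact_mod_cast hρ1, LipschitzWith.of_dist_le_mul ?_⟩
    rintro ⟨y, hy, _⟩ ⟨z, hz, _⟩
    rw [Subtype.dist_eq, Subtype.dist_eq, dist_eq_norm, dist_eq_norm]
    simp only [Set.MapsTo.val_restrict_apply, F]
    have e : h • (x + y * y) - h • (x + z * z) = h • (y * (y - z) + (y - z) * z) := by
      rw [← smul_sub]; congr 1; noncomm_ring
    rw [e, norm_smul, hh]
    have h1 : ‖y * (y - z) + (y - z) * z‖ ≤ ρ * ‖y - z‖ + ‖y - z‖ * ρ :=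
      (norm_add_le _ _).trans (add_le_add ((norm_mul_le _ _).trans (by gcongr))
        ((norm_mul_le _ _).trans (by gcongr)))
    change _ ≤ ρ * ‖y - z‖
    linarith
  have h0 : (0 : X) ∈ S := ⟨by simpa using hρ0, star_zero X⟩
  obtain ⟨y, ⟨_, hys⟩, hyf, -⟩ :=
    hcontr.exists_fixedPoint' hScl.isComplete hmaps h0 (edist_ne_top _ _)
  refine ⟨y, hys, ?_⟩
  have h2 : h • (x + y * y) = y := hyf
  have h3 : x + y * y = y + y := by
    have : (2 : 𝕜) • (h • (x + y * y)) = (2 : 𝕜) • y := by rw [h2]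
    rwa [smul_smul, mul_inv_cancel₀ two_ne_zero, one_smul, two_smul] at this
  rw [← h3]; abel

/-- A `*`-homomorphism from a Banach `*`-algebra with isometric involution into the bounded
operators on a Hilbert space is norm-decreasing. -/
theorem norm_starHom_le {X : Type*} {𝕜 : Type*} [RCLike 𝕜] [NonUnitalNormedRing X]
    [StarRing X] [NormedStarGroup X] [NormedSpace 𝕜 X] [IsScalarTower 𝕜 X X] [SMulCommClass 𝕜 X X]
    [StarModule 𝕜 X] [CompleteSpace X] {H : Type*} [NormedAddCommGroup H] [InnerProductSpace 𝕜 H]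
    [CompleteSpace H] (φ : X →⋆ₙₐ[𝕜] (H →L[𝕜] H)) (x : X) : ‖φ x‖ ≤ ‖x‖ := by
  have key : ∀ x : X, ‖x‖ < 1 → ‖φ x‖ ≤ 1 := by
    intro x hx
    obtain ⟨y, hys, hy⟩ := exists_selfAdjoint_two_sub_sq (𝕜 := 𝕜) (star x * x)
      (by simp) (((norm_mul_le _ _).trans_eq (by rw [norm_star])).trans_lt
        (by nlinarith [norm_nonneg x]))
    refine ContinuousLinearMap.opNorm_le_bound _ zero_le_one fun ξ => ?_
    have hsa : ContinuousLinearMap.adjoint (φ y) = φ y := by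
      rw [← ContinuousLinearMap.star_eq_adjoint, ← map_star, hys]
    have e1 : ContinuousLinearMap.adjoint (φ x) (φ x ξ) = φ y ξ + φ y ξ - φ y (φ y ξ) := by
      have := congrArg (fun T => φ T ξ) hy
      simpa [map_star, ContinuousLinearMap.star_eq_adjoint] using this
    have e2 : ‖φ x ξ‖ ^ 2 = RCLike.re (inner 𝕜 ξ (φ y ξ + φ y ξ - φ y (φ y ξ))) := by
      rw [← e1, ContinuousLinearMap.adjoint_inner_right, inner_self_eq_norm_sq]
    have e3 : inner 𝕜 ξ (φ y (φ y ξ)) = inner 𝕜 (φ y ξ) (φ y ξ) := by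
      conv_lhs => rw [← hsa]
      rw [ContinuousLinearMap.adjoint_inner_right, hsa]
    have e4 : ‖ξ - φ y ξ‖ ^ 2 = ‖ξ‖ ^ 2 - ‖φ x ξ‖ ^ 2 := by
      rw [e2, inner_sub_right, inner_add_right, e3, @norm_sub_sq 𝕜, map_sub, map_add,
        inner_self_eq_norm_sq]
      ring
    nlinarith [sq_nonneg ‖ξ - φ y ξ‖, norm_nonneg (φ x ξ), norm_nonneg ξ]
  refine le_of_forall_gt_imp_ge_of_dense fun r hr => ?_
  have hr0 : 0 < r := (norm_nonneg x).trans_lt hr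
  have h1 := key ((((r⁻¹ : ℝ) : 𝕜)) • x) (by
    rw [norm_smul, RCLike.norm_ofReal, abs_of_pos (inv_pos.2 hr0), inv_mul_lt_iff₀ hr0]; simpa)
  rw [map_smul, norm_smul, RCLike.norm_ofReal, abs_of_pos (inv_pos.2 hr0),
    inv_mul_le_iff₀ hr0] at h1
  simpa using h1

section BlockDiagonal

variable {Ω 𝕜 : Type*} [RCLike 𝕜] {H : Ω → Type*} [∀ ω, NormedAddCommGroup (H ω)]
  [∀ ω, InnerProductSpace 𝕜 (H ω)]

theorem norm_blockDiag_apply_le (x : lp (fun ω => H ω →L[𝕜] H ω) ∞) (f : lp H 2) (ω : Ω) :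
    ‖x ω (f ω)‖ ≤ ‖(((‖x‖ : ℝ) : 𝕜) • f : lp H 2) ω‖ := by
  rw [lp.coeFn_smul, Pi.smul_apply, norm_smul, RCLike.norm_ofReal, abs_of_nonneg (norm_nonneg x)]
  exact (x ω).le_of_opNorm_le (lp.norm_apply_le_norm ENNReal.top_ne_zero x ω) (f ω)

/-- The block-diagonal operator on the Hilbert sum given by a bounded family of operators. -/
noncomputable def blockDiag (x : lp (fun ω => H ω →L[𝕜] H ω) ∞) : lp H 2 →L[𝕜] lp H 2 :=
  LinearMap.mkContinuous
    { toFun := fun f => ⟨fun ω => x ω (f ω),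
        (lp.memℓp (((‖x‖ : ℝ) : 𝕜) • f : lp H 2)).mono' (norm_blockDiag_apply_le x f)⟩
      map_add' := fun f g => by ext ω; simp; rfl
      map_smul' := fun c f => by ext ω; simp }
    ‖x‖ fun f => by
      refine (lp.norm_mono (y := ((‖x‖ : ℝ) : 𝕜) • f) two_ne_zero
        (norm_blockDiag_apply_le x f)).trans_eq ?_
      rw [norm_smul, RCLike.norm_ofReal, abs_of_nonneg (norm_nonneg x)]

theorem blockDiag_apply (x : lp (fun ω => H ω →L[𝕜] H ω) ∞) (f : lp H 2) (ω : Ω) :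
    blockDiag x f ω = x ω (f ω) := rfl

theorem norm_blockDiag (x : lp (fun ω => H ω →L[𝕜] H ω) ∞) : ‖blockDiag x‖ = ‖x‖ := by
  classical
  refine le_antisymm (LinearMap.mkContinuous_norm_le _ (norm_nonneg x) _)
    (lp.norm_le_of_forall_le (norm_nonneg _) fun ω =>
      ContinuousLinearMap.opNorm_le_bound _ (norm_nonneg _) fun ξ => ?_)
  have h1 := (blockDiag x).le_opNorm (lp.single 2 ω ξ)
  rw [lp.norm_single (by norm_num)] at h1
  refine le_trans ?_ h1
  have h2 := lp.norm_apply_le_norm two_ne_zero (blockDiag x (lp.single 2 ω ξ)) ω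
  rwa [blockDiag_apply, lp.single_apply_self] at h2

variable [∀ ω, CompleteSpace (H ω)]

/-- Block-diagonal operators as a `*`-homomorphism. -/
noncomputable def blockDiagHom :
    lp (fun ω => H ω →L[𝕜] H ω) ∞ →⋆ₙₐ[𝕜] (lp H 2 →L[𝕜] lp H 2) where
  toFun := blockDiag
  map_smul' _ _ := rfl
  map_zero' := rfl
  map_add' _ _ := rfl
  map_mul' _ _ := rfl
  map_star' x := by
    rw [ContinuousLinearMap.star_eq_adjoint, ContinuousLinearMap.eq_adjoint_iff]
    intro f g
    rw [lp.inner_eq_tsum, lp.inner_eq_tsum]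
    refine tsum_congr fun ω => ?_
    rw [blockDiag_apply, blockDiag_apply, lp.coeFn_star, Pi.star_apply,
      ContinuousLinearMap.star_eq_adjoint, ContinuousLinearMap.adjoint_inner_left]

theorem isometry_blockDiagHom : Isometry (blockDiagHom (𝕜 := 𝕜) (H := H)) :=
  AddMonoidHomClass.isometry_of_norm _ norm_blockDiag

end BlockDiagonal

/-! ### Universal contraction C⋆-algebras -/

/-- A family of contractions, indexed by `ι`, on a Hilbert space over `𝕜`. -/
structure ContractionFamily (𝕜 : Type) [RCLike 𝕜] (ι : Type) where
  H : Type u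
  [normed : NormedAddCommGroup H]
  [inner : InnerProductSpace 𝕜 H]
  [complete : CompleteSpace H]
  T : ι → (H →L[𝕜] H)
  norm_le : ∀ i, ‖T i‖ ≤ 1

attribute [instance] ContractionFamily.normed ContractionFamily.inner ContractionFamily.complete

section Universal

variable (𝕜 : Type) [RCLike 𝕜] (ι : Type)

/-- The `ℓ^∞`-product of the algebras `B(H)` over all contraction families, with coordinatewise
operations and the supremum norm. -/
def ContractionProduct : Type (u + 1) :=
  lp (fun ω : ContractionFamily.{u} 𝕜 ι => ω.H →L[𝕜] ω.H) ∞

namespace ContractionProduct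

noncomputable instance : NonUnitalNormedRing (ContractionProduct.{u} 𝕜 ι) :=
  inferInstanceAs (NonUnitalNormedRing (lp (fun ω : ContractionFamily.{u} 𝕜 ι => ω.H →L[𝕜] ω.H) ∞))

noncomputable instance : StarRing (ContractionProduct.{u} 𝕜 ι) :=
  inferInstanceAs (StarRing (lp (fun ω : ContractionFamily.{u} 𝕜 ι => ω.H →L[𝕜] ω.H) ∞))

noncomputable instance : NormedStarGroup (ContractionProduct.{u} 𝕜 ι) :=
  inferInstanceAs (NormedStarGroup (lp (fun ω : ContractionFamily.{u} 𝕜 ι => ω.H →L[𝕜] ω.H) ∞))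

noncomputable instance : NormedSpace 𝕜 (ContractionProduct.{u} 𝕜 ι) :=
  inferInstanceAs (NormedSpace 𝕜 (lp (fun ω : ContractionFamily.{u} 𝕜 ι => ω.H →L[𝕜] ω.H) ∞))

instance : IsScalarTower 𝕜 (ContractionProduct.{u} 𝕜 ι) (ContractionProduct.{u} 𝕜 ι) :=
  inferInstanceAs (IsScalarTower 𝕜 (lp (fun ω : ContractionFamily.{u} 𝕜 ι => ω.H →L[𝕜] ω.H) ∞)
    (lp (fun ω : ContractionFamily.{u} 𝕜 ι => ω.H →L[𝕜] ω.H) ∞))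

instance : SMulCommClass 𝕜 (ContractionProduct.{u} 𝕜 ι) (ContractionProduct.{u} 𝕜 ι) :=
  inferInstanceAs (SMulCommClass 𝕜 (lp (fun ω : ContractionFamily.{u} 𝕜 ι => ω.H →L[𝕜] ω.H) ∞)
    (lp (fun ω : ContractionFamily.{u} 𝕜 ι => ω.H →L[𝕜] ω.H) ∞))

instance : StarModule 𝕜 (ContractionProduct.{u} 𝕜 ι) :=
  inferInstanceAs (StarModule 𝕜 (lp (fun ω : ContractionFamily.{u} 𝕜 ι => ω.H →L[𝕜] ω.H) ∞))

instance : CompleteSpace (ContractionProduct.{u} 𝕜 ι) :=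
  inferInstanceAs (CompleteSpace (lp (fun ω : ContractionFamily.{u} 𝕜 ι => ω.H →L[𝕜] ω.H) ∞))

variable {𝕜 ι}

/-- The coordinate of an element of the product at a contraction family. -/
noncomputable def coord (ω : ContractionFamily.{u} 𝕜 ι) :
    ContractionProduct.{u} 𝕜 ι →⋆ₙₐ[𝕜] (ω.H →L[𝕜] ω.H) where
  toFun x := (show lp (fun ω : ContractionFamily.{u} 𝕜 ι => ω.H →L[𝕜] ω.H) ∞ from x) ω
  map_smul' _ _ := rfl
  map_zero' := rfl
  map_add' _ _ := rfl
  map_mul' _ _ := rfl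
  map_star' _ := rfl

theorem norm_coord_le (ω : ContractionFamily.{u} 𝕜 ι) (x : ContractionProduct.{u} 𝕜 ι) :
    ‖coord ω x‖ ≤ ‖x‖ :=
  lp.norm_apply_le_norm (E := fun ω : ContractionFamily.{u} 𝕜 ι => ω.H →L[𝕜] ω.H)
    ENNReal.top_ne_zero x ω

/-- The element of the product whose coordinate at each contraction family is its `i`-th member. -/
noncomputable def gen (i : ι) : ContractionProduct.{u} 𝕜 ι :=
  (⟨fun ω => ω.T i, memℓp_infty ⟨1, by rintro _ ⟨ω, rfl⟩; exact ω.norm_le i⟩⟩ :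
    lp (fun ω : ContractionFamily.{u} 𝕜 ι => ω.H →L[𝕜] ω.H) ∞)

theorem norm_gen_le (i : ι) : ‖gen.{u} (𝕜 := 𝕜) i‖ ≤ 1 :=
  lp.norm_le_of_forall_le zero_le_one fun ω => ω.norm_le i

end ContractionProduct

/-- The closed `*`-subalgebra generated by the universal family `ContractionProduct.gen`. -/
noncomputable def universalSubalgebra :
    NonUnitalStarSubalgebra 𝕜 (ContractionProduct.{u} 𝕜 ι) :=
  (NonUnitalStarAlgebra.adjoin 𝕜
    (Set.range (ContractionProduct.gen.{u} (𝕜 := 𝕜) (ι := ι)))).topologicalClosure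

/-- The universal contraction C⋆-algebra over `𝕜` on generators indexed by `ι`, realised as the
closed `*`-subalgebra generated by the universal family in the product over all contraction
families. It is a C⋆-algebra (`UniversalContraction.instCStarAlgebraOver`) and has the defining
universal property (`UniversalContraction.existsUnique_hom`). -/
def UniversalContraction : Type (u + 1) := universalSubalgebra.{u} 𝕜 ι

namespace UniversalContraction

noncomputable instance : NonUnitalNormedRing (UniversalContraction.{u} 𝕜 ι) :=
  inferInstanceAs (NonUnitalNormedRing (universalSubalgebra.{u} 𝕜 ι))

noncomputable instance : StarRing (UniversalContraction.{u} 𝕜 ι) :=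
  inferInstanceAs (StarRing (universalSubalgebra.{u} 𝕜 ι))

noncomputable instance : NormedStarGroup (UniversalContraction.{u} 𝕜 ι) where
  norm_star_le x := (norm_star (x : universalSubalgebra.{u} 𝕜 ι).1).le

noncomputable instance : NormedSpace 𝕜 (UniversalContraction.{u} 𝕜 ι) :=
  inferInstanceAs (NormedSpace 𝕜 (universalSubalgebra.{u} 𝕜 ι))

instance : IsScalarTower 𝕜 (UniversalContraction.{u} 𝕜 ι) (UniversalContraction.{u} 𝕜 ι) :=
  inferInstanceAs (IsScalarTower 𝕜 (universalSubalgebra.{u} 𝕜 ι) (universalSubalgebra.{u} 𝕜 ι))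

instance : SMulCommClass 𝕜 (UniversalContraction.{u} 𝕜 ι) (UniversalContraction.{u} 𝕜 ι) :=
  inferInstanceAs (SMulCommClass 𝕜 (universalSubalgebra.{u} 𝕜 ι) (universalSubalgebra.{u} 𝕜 ι))

instance : StarModule 𝕜 (UniversalContraction.{u} 𝕜 ι) :=
  inferInstanceAs (StarModule 𝕜 (universalSubalgebra.{u} 𝕜 ι))

instance : CompleteSpace (UniversalContraction.{u} 𝕜 ι) :=
  (NonUnitalStarSubalgebra.isClosed_topologicalClosure _).completeSpace_coe

variable {𝕜 ι}

/-- The inclusion into the product. -/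
noncomputable def incl : UniversalContraction.{u} 𝕜 ι →⋆ₙₐ[𝕜] ContractionProduct.{u} 𝕜 ι :=
  NonUnitalStarSubalgebraClass.subtype (universalSubalgebra.{u} 𝕜 ι)

theorem isometry_incl : Isometry (incl.{u} (𝕜 := 𝕜) (ι := ι)) := fun _ _ => rfl

/-- The generators of the universal contraction C⋆-algebra. -/
noncomputable def gen (i : ι) : UniversalContraction.{u} 𝕜 ι :=
  (⟨ContractionProduct.gen i, NonUnitalStarSubalgebra.le_topologicalClosure _
    (NonUnitalStarAlgebra.subset_adjoin 𝕜 _ ⟨i, rfl⟩)⟩ : universalSubalgebra.{u} 𝕜 ι)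

theorem norm_gen_le (i : ι) : ‖gen.{u} (𝕜 := 𝕜) i‖ ≤ 1 := ContractionProduct.norm_gen_le i

/-- The generators generate the universal contraction C⋆-algebra. -/
theorem dense_adjoin_gen :
    Dense (NonUnitalStarAlgebra.adjoin 𝕜 (Set.range (gen.{u} (𝕜 := 𝕜) (ι := ι))) :
      Set (UniversalContraction.{u} 𝕜 ι)) := by
  have himg : incl.{u} '' (NonUnitalStarAlgebra.adjoin 𝕜
      (Set.range (gen.{u} (𝕜 := 𝕜) (ι := ι))) : Set (UniversalContraction.{u} 𝕜 ι)) =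
      (NonUnitalStarAlgebra.adjoin 𝕜
        (Set.range (ContractionProduct.gen.{u} (𝕜 := 𝕜) (ι := ι))) : Set _) := by
    rw [← NonUnitalStarSubalgebra.coe_map, NonUnitalStarAlgHom.map_adjoin, ← Set.range_comp]
    rfl
  intro x
  rw [isometry_incl.isEmbedding.isInducing.closure_eq_preimage_closure_image, Set.mem_preimage,
    himg]
  exact (x : universalSubalgebra.{u} 𝕜 ι).2

instance instCStarAlgebraOver : CStarAlgebraOver 𝕜 (UniversalContraction.{u} 𝕜 ι) where
  complete := inferInstance
  exists_isometric_rep := by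
    let ρ : ContractionProduct.{u} 𝕜 ι →⋆ₙₐ[𝕜] _ :=
      blockDiagHom (𝕜 := 𝕜) (H := fun ω : ContractionFamily.{u} 𝕜 ι => ω.H)
    exact ⟨lp (fun ω : ContractionFamily.{u} 𝕜 ι => ω.H) 2, inferInstance, inferInstance,
      inferInstance, ρ.comp incl, isometry_blockDiagHom.comp isometry_incl⟩

/-- The universal property: a family of contractions in a C⋆-algebra over `𝕜` extends uniquely from
the generators to a `*`-homomorphism. -/
theorem existsUnique_hom {A : Type u} [NonUnitalNormedRing A] [StarRing A] [NormedSpace 𝕜 A]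
    [IsScalarTower 𝕜 A A] [SMulCommClass 𝕜 A A] [StarModule 𝕜 A] [CStarAlgebraOver 𝕜 A]
    (a : ι → A) (ha : ∀ i, ‖a i‖ ≤ 1) :
    ∃! π : UniversalContraction.{u} 𝕜 ι →⋆ₙₐ[𝕜] A, ∀ i, π (gen i) = a i := by
  have : CompleteSpace A := CStarAlgebraOver.complete 𝕜
  obtain ⟨H, _, _, _, φ, hφ⟩ := CStarAlgebraOver.exists_isometric_rep (𝕜 := 𝕜) (A := A)
  have hnorm : ∀ x : A, ‖φ x‖ = ‖x‖ := (AddMonoidHomClass.isometry_iff_norm φ).1 hφ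
  refine existsUnique_of_exists_of_unique ?_ ?_
  · let ω : ContractionFamily.{u} 𝕜 ι := ⟨H, fun i => φ (a i), fun i => (hnorm _).trans_le (ha i)⟩
    let ε : UniversalContraction.{u} 𝕜 ι →⋆ₙₐ[𝕜] (H →L[𝕜] H) :=
      (ContractionProduct.coord ω).comp incl
    have hε : Continuous ε :=
      AddMonoidHomClass.continuous_of_bound ε 1 fun x => by
        rw [one_mul]; exact norm_starHom_le ε x
    have hmem : ∀ x, ε x ∈ NonUnitalStarAlgHom.range φ := by
      have hcl : IsClosed (ε ⁻¹' (NonUnitalStarAlgHom.range φ : Set (H →L[𝕜] H))) := by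
        refine IsClosed.preimage hε ?_
        rw [NonUnitalStarAlgHom.coe_range]
        exact hφ.isClosedEmbedding.isClosed_range
      have hle : NonUnitalStarAlgebra.adjoin 𝕜 (Set.range (gen.{u} (𝕜 := 𝕜) (ι := ι))) ≤
          (NonUnitalStarAlgHom.range φ).comap ε := by
        rw [NonUnitalStarAlgebra.adjoin_le_iff]
        rintro _ ⟨i, rfl⟩
        exact ⟨a i, rfl⟩
      intro x
      have : closure (NonUnitalStarAlgebra.adjoin 𝕜
          (Set.range (gen.{u} (𝕜 := 𝕜) (ι := ι))) : Set (UniversalContraction.{u} 𝕜 ι)) ⊆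
          ε ⁻¹' (NonUnitalStarAlgHom.range φ : Set (H →L[𝕜] H)) := closure_minimal hle hcl
      exact this (dense_adjoin_gen x)
    choose g hg using hmem
    have hg : ∀ x, φ (g x) = ε x := hg
    refine ⟨{ toFun := g, map_smul' := ?_, map_zero' := ?_, map_add' := ?_, map_mul' := ?_,
              map_star' := ?_ }, ?_⟩
    · intro c x; apply hφ.injective; simp [hg]
    · apply hφ.injective; simp [hg]
    · intro x y; apply hφ.injective; simp [hg]
    · intro x y; apply hφ.injective; simp [hg]
    · intro x; apply hφ.injective; simp [hg, map_star]
    · intro i; apply hφ.injective; exact hg (gen i)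
  · intro π₁ π₂ h₁ h₂
    have hc : ∀ π : UniversalContraction.{u} 𝕜 ι →⋆ₙₐ[𝕜] A, Continuous π := fun π =>
      AddMonoidHomClass.continuous_of_bound π 1 fun x => by
        rw [one_mul, ← hnorm]; exact norm_starHom_le (φ.comp π) x
    have hle : NonUnitalStarAlgebra.adjoin 𝕜 (Set.range (gen.{u} (𝕜 := 𝕜) (ι := ι))) ≤
        NonUnitalStarAlgHom.equalizer π₁ π₂ := by
      rw [NonUnitalStarAlgebra.adjoin_le_iff]
      rintro _ ⟨i, rfl⟩
      exact (h₁ i).trans (h₂ i).symm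
    exact DFunLike.ext' (Continuous.ext_on dense_adjoin_gen (hc π₁) (hc π₂) fun x hx => hle hx)

/-- The canonical `*`-homomorphism from the universal contraction C⋆-algebra that sends the
generators to a given family of contractions. -/
noncomputable def lift {A : Type u} [NonUnitalNormedRing A] [StarRing A] [NormedSpace 𝕜 A]
    [IsScalarTower 𝕜 A A] [SMulCommClass 𝕜 A A] [StarModule 𝕜 A] [CStarAlgebraOver 𝕜 A]
    (a : ι → A) (ha : ∀ i, ‖a i‖ ≤ 1) : UniversalContraction.{u} 𝕜 ι →⋆ₙₐ[𝕜] A :=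
  (existsUnique_hom a ha).choose

theorem lift_gen {A : Type u} [NonUnitalNormedRing A] [StarRing A] [NormedSpace 𝕜 A]
    [IsScalarTower 𝕜 A A] [SMulCommClass 𝕜 A A] [StarModule 𝕜 A] [CStarAlgebraOver 𝕜 A]
    (a : ι → A) (ha : ∀ i, ‖a i‖ ≤ 1) (i : ι) : lift.{u} (𝕜 := 𝕜) a ha (gen i) = a i :=
  (existsUnique_hom a ha).choose_spec.1 i

variable (𝕜) in
/-- The standard presentation of the universal contraction C⋆-algebra on a sequence of `n`
generators, `n` finite or infinite. -/
noncomputable def standardPresentation (n : ℕ∞) :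
    CStarPresentation 𝕜 (UniversalContraction.{u} 𝕜 (SeqIndex n)) where
  length := n
  point := gen
  generates := dense_adjoin_gen

end UniversalContraction

end Universal

/-- The word problem of a presentation by contractions: the kernel of the natural map from the
universal contraction C⋆-algebra on equally many generators onto `A`. -/
def CStarPresentation.wordProblem {𝕜 : Type} [RCLike 𝕜] {A : Type u} [NonUnitalNormedRing A]
    [StarRing A] [NormedSpace 𝕜 A] [IsScalarTower 𝕜 A A] [SMulCommClass 𝕜 A A] [StarModule 𝕜 A]
    [CStarAlgebraOver 𝕜 A] (P : CStarPresentation 𝕜 A) (hP : ∀ j, ‖P.point j‖ ≤ 1) :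
    Set (UniversalContraction.{u} 𝕜 (SeqIndex P.length)) :=
  {x | UniversalContraction.lift P.point hP x = 0}

/-! Let `π` be the canonical map from the universal contraction algebra to `A`; its kernel is the
word problem. The distance from `x` to the kernel is `‖π x‖`, and it is attained. Hence an open ball
of radius `r` about `x` meets the kernel iff `‖π x‖ < r`, and a closed one misses it iff `r < ‖π
x‖`. Since `π` carries each standard rational point to the rational point of `A` with the same code,
the two halves of strong computability say that the strict upper, respectively lower, dyadic bounds
of the norm are c.e. For a nonnegative function on codes the two together amount to computability.

The inequality `‖π x‖ ≤ ‖x - y‖` for `y` in the kernel is contractivity of `π`. Attainment is the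
analytic core (`exists_norm_le_map_eq`): with `r = ‖π x‖ > 0`, cut `x` down to `c = x f(x* x)`,
where `f(t) = min(1, r / √|t|)`. Then `‖c‖ ≤ r` because `√|t| f(t) ≤ r`, and `π c = π x` because `f
= 1` on `[-r², r²]`, which contains the spectrum of `π(x* x)`. To treat real and complex scalars
alike, `f` is approximated by real polynomials, and the only functional calculus needed is the bound
`‖p(T)‖ ≤ sup |p|` over `[-‖T‖, ‖T‖]` for self-adjoint `T`. That bound follows from the
finite-dimensional spectral theorem. -/

/-! ### Real polynomials in a self-adjoint operator -/

section SelfAdjointPolynomial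

variable {𝕜 : Type*} [RCLike 𝕜]

/-- A symmetric operator on a finite-dimensional space bounded by `M` satisfies
`‖p(T)‖ ≤ sup_{|t| ≤ M} |p(t)|`. -/
theorem LinearMap.IsSymmetric.norm_aeval_apply_le {E : Type*} [NormedAddCommGroup E]
    [InnerProductSpace 𝕜 E] [FiniteDimensional 𝕜 E] {T : E →ₗ[𝕜] E} (hT : T.IsSymmetric) {M C : ℝ}
    (hM : ∀ v, ‖T v‖ ≤ M * ‖v‖) (p : Polynomial ℝ) (hp : ∀ t ∈ Set.Icc (-M) M, |p.eval t| ≤ C)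
    (v : E) : ‖Polynomial.aeval T (p.map (algebraMap ℝ 𝕜)) v‖ ≤ C * ‖v‖ := by
  set b := hT.eigenvectorBasis rfl
  set l := hT.eigenvalues rfl
  have hl : ∀ i, |l i| ≤ M := fun i => by
    have h := hM (b i)
    rw [hT.apply_eigenvectorBasis rfl i, norm_smul, b.norm_eq_one, RCLike.norm_ofReal] at h
    simpa using h
  have hpl : ∀ i, |p.eval (l i)| ≤ C := fun i => hp _ (abs_le.1 (hl i))
  rcases (norm_nonneg v).eq_or_lt with hv | hv
  · rw [eq_comm, norm_eq_zero] at hv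
    simp [hv]
  have hC : 0 ≤ C := by
    by_contra hC
    -- A negative `C` would leave no eigenvalues at all, so Parseval would force `v = 0`.
    have h0 : ∀ i, False := fun i => hC ((abs_nonneg _).trans (hpl i))
    have h := b.sum_sq_norm_inner_right v
    rw [Finset.sum_eq_zero fun i _ => (h0 i).elim] at h
    nlinarith
  -- In the eigenbasis `p(T)` multiplies the `i`-th coordinate by `p(l i)`; Parseval then gives the
  -- bound.
  have hin : ∀ i, inner 𝕜 (b i) (Polynomial.aeval T (p.map (algebraMap ℝ 𝕜)) v) =
      ((p.eval (l i) : ℝ) : 𝕜) * inner 𝕜 (b i) v := fun i => by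
    conv_lhs => rw [← b.sum_repr' v]
    rw [map_sum, inner_sum, Finset.sum_eq_single i]
    · rw [map_smul, Module.End.aeval_apply_of_hasEigenvector
        (hT.hasEigenvector_eigenvectorBasis rfl i), inner_smul_right, inner_smul_right,
        orthonormal_iff_ite.1 b.orthonormal]
      rw [← RCLike.algebraMap_eq_ofReal, Polynomial.eval_map_algebraMap,
        Polynomial.aeval_algebraMap_apply]
      simp [mul_comm, l, Polynomial.aeval_def, Polynomial.eval₂_eq_eval_map]
    · intro j _ hj
      rw [map_smul, Module.End.aeval_apply_of_hasEigenvector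
        (hT.hasEigenvector_eigenvectorBasis rfl j), inner_smul_right, inner_smul_right,
        orthonormal_iff_ite.1 b.orthonormal]
      simp [hj.symm]
    · simp
  refine le_of_sq_le_sq ?_ (by positivity)
  rw [← b.sum_sq_norm_inner_right, mul_pow, ← b.sum_sq_norm_inner_right v, Finset.mul_sum]
  refine Finset.sum_le_sum fun i _ => ?_
  rw [hin, norm_mul, RCLike.norm_ofReal, mul_pow]
  gcongr
  exact hpl i

variable {H : Type*} [NormedAddCommGroup H] [InnerProductSpace 𝕜 H]

/-- A self-adjoint operator on a Hilbert space satisfies `‖p(T)‖ ≤ sup_{|t| ≤ M} |p(t)|` whenever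
`‖T‖ ≤ M`. -/
theorem IsSelfAdjoint.norm_aeval_le [CompleteSpace H] {T : H →L[𝕜] H} (hT : IsSelfAdjoint T)
    {M C : ℝ} (hM : ‖T‖ ≤ M) (p : Polynomial ℝ) (hp : ∀ t ∈ Set.Icc (-M) M, |p.eval t| ≤ C) :
    ‖Polynomial.aeval T (p.map (algebraMap ℝ 𝕜))‖ ≤ C := by
  have hM0 : 0 ≤ M := (norm_nonneg T).trans hM
  have hC : 0 ≤ C := (abs_nonneg _).trans (hp 0 ⟨by linarith, hM0⟩)
  refine ContinuousLinearMap.opNorm_le_bound _ hC fun ξ => ?_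
  set q := p.map (algebraMap ℝ 𝕜)
  -- For a fixed vector `ξ`, only the span of `ξ, T ξ, …, T ^ deg ξ` matters. The compression `S` of
  -- `T` to this finite-dimensional space is symmetric, is bounded by `M`, and satisfies `p(S) ξ =
  -- p(T) ξ`.
  let V : Submodule 𝕜 H :=
    Submodule.span 𝕜 (Set.range fun j : Fin (q.natDegree + 1) => (T ^ (j : ℕ)) ξ)
  have hV : ∀ j ≤ q.natDegree, (T ^ j) ξ ∈ V := fun j hj =>
    Submodule.subset_span ⟨⟨j, Nat.lt_succ_of_le hj⟩, rfl⟩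
  have : FiniteDimensional 𝕜 V := FiniteDimensional.span_of_finite 𝕜 (Set.finite_range _)
  let S : V →L[𝕜] V := V.orthogonalProjectionOnto ∘L T ∘L V.subtypeL
  have hS : (S : V →ₗ[𝕜] V).IsSymmetric := fun x y => by
    have hsym : inner 𝕜 (T x) (y : H) = inner 𝕜 (x : H) (T y) := hT.isSymmetric x y
    change inner 𝕜 (V.starProjection (T x)) (y : H) = inner 𝕜 (x : H) (V.starProjection (T y))
    rw [Submodule.inner_starProjection_left_eq_right V (T x),
      ← Submodule.inner_starProjection_left_eq_right V (x : H),
      Submodule.starProjection_eq_self_iff.2 x.2, Submodule.starProjection_eq_self_iff.2 y.2, hsym]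
  have hSM : ∀ v : V, ‖(S : V →ₗ[𝕜] V) v‖ ≤ M * ‖v‖ := fun v =>
    (V.norm_orthogonalProjectionOnto_apply_le _).trans (T.le_of_opNorm_le hM _)
  let η : V := ⟨ξ, by simpa using hV 0 (Nat.zero_le _)⟩
  have hpow : ∀ j ≤ q.natDegree, ((((S : V →ₗ[𝕜] V) ^ j) η : V) : H) = (T ^ j) ξ := by
    intro j
    induction j with
    | zero => intro _; simp [η]
    | succ j ih =>
      intro hj
      rw [pow_succ', pow_succ', Module.End.mul_apply, mul_apply_eq_comp,
        ← ih (by omega)]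
      -- Up to the degree of `q` the next iterate stays in `V`, so the projection in `S` does not
      -- change it.
      have h1 : T ((((S : V →ₗ[𝕜] V) ^ j) η : V) : H) ∈ V := by
        have h2 := hV (j + 1) hj
        rwa [pow_succ', mul_apply_eq_comp, ← ih (by omega)] at h2
      exact congrArg Subtype.val
        (Submodule.orthogonalProjectionOnto_mem_subspace_eq_self (K := V) ⟨_, h1⟩)
  have key : ((Polynomial.aeval (S : V →ₗ[𝕜] V) q η : V) : H) = Polynomial.aeval T q ξ := by
    rw [Polynomial.aeval_eq_sum_range, Polynomial.aeval_eq_sum_range]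
    simp only [LinearMap.sum_apply, sum_apply, LinearMap.smul_apply,
      smul_apply, Submodule.coe_sum, Submodule.coe_smul]
    exact Finset.sum_congr rfl fun j hj => by
      rw [hpow j (Nat.lt_succ_iff.1 (Finset.mem_range.1 hj))]
  rw [← key]
  exact hS.norm_aeval_apply_le hSM p hp η

end SelfAdjointPolynomial

/-! ### Computable real-valued functions on codes -/

section Computability

open Nat.Partrec

variable {α : Type*} [Primcodable α]

/-- A recursively enumerable predicate is the projection of a decidable one. -/
theorem REPred.exists_computable {p : α → Prop} (hp : REPred p) :
    ∃ g : α × ℕ → Bool, Computable g ∧ ∀ a, p a ↔ ∃ n, g (a, n) = true := by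
  obtain ⟨c, hc⟩ := Code.exists_code.1 hp
  -- The witness `n` is a step bound: running a program for boundedly many steps is primitive
  -- recursive, and halting means halting within some bound.
  refine ⟨fun x => (Code.evaln x.2 c (Encodable.encode x.1)).isSome, ?_, fun a => ?_⟩
  · exact (Primrec.option_isSome.comp (Code.primrec_evaln.comp
      (((Primrec.snd.pair (Primrec.const c))).pair
        (Primrec.encode.comp Primrec.fst)))).to_comp
  · have h : (c.eval (Encodable.encode a)).Dom ↔ p a := by
      rw [hc]; simp [Part.assert, Encodable.encodek]
    rw [← h, Part.dom_iff_mem]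
    simp only [Option.isSome_iff_exists, Code.evaln_complete, Option.mem_def]
    exact exists_comm

/-- The projection of a computable predicate is recursively enumerable. -/
theorem REPred.of_exists_computable {p : α → Prop} (g : α × ℕ → Bool) (hg : Computable g)
    (h : ∀ a, p a ↔ ∃ n, g (a, n) = true) : REPred p := by
  have h1 : Partrec fun a => Nat.rfind fun n => Part.some (g (a, n)) :=
    Partrec.rfind (p := fun a n => Part.some (g (a, n))) hg.partrec
  refine h1.dom_re.of_eq fun a => ?_
  rw [h a]
  refine Nat.rfind_dom.trans (exists_congr fun n => ?_)
  exact ⟨fun hn => (Part.mem_some_iff.1 hn.1).symm,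
    fun hn => ⟨Part.mem_some_iff.2 hn.symm, fun _ => trivial⟩⟩

/-! ### Comparing rational approximations with dyadic rationals. -/

theorem Primrec.nat_two_pow : Primrec fun n : ℕ => 2 ^ n := by
  have h : Primrec₂ fun _ y : ℕ => 2 * y := Primrec.nat_mul.comp (Primrec.const 2) Primrec.snd
  refine (Primrec.nat_rec₁ 1 h).of_eq fun n => ?_
  induction n with
  | zero => rfl
  | succ n ih => rw [pow_succ', ← ih]

/-- Clearing denominators and moving negative terms across leaves an inequality of natural numbers,
which is primitive recursive in the codes. -/
theorem RatCode.val_add_lt_dyadicCode_val (q : RatCode) (k : ℕ) (d : DyadicCode) :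
    ((RatCode.val q : ℚ) : ℝ) + ((2 : ℝ) ^ k)⁻¹ < DyadicCode.val d ↔
      q.1 * 2 ^ k * 2 ^ d.2 + (q.2.2 + 1) * 2 ^ d.2 <
        (d.1 + 1) * (q.2.2 + 1) * 2 ^ k + q.2.1 * 2 ^ k * 2 ^ d.2 := by
  rw [← Nat.cast_lt (α := ℝ)]
  push_cast [RatCode.val, DyadicCode.val]
  have h1 : (0 : ℝ) < 2 ^ k := by positivity
  have h2 : (0 : ℝ) < 2 ^ d.2 := by positivity
  have h3 : (0 : ℝ) < (q.2.2 : ℝ) + 1 := by positivity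
  rw [← one_div, div_add_div _ _ h3.ne' h1.ne', div_lt_div_iff₀ (by positivity) h2]
  constructor <;> intro h <;> nlinarith

theorem RatCode.dyadicCode_val_lt_val_sub (q : RatCode) (k : ℕ) (d : DyadicCode) :
    DyadicCode.val d < ((RatCode.val q : ℚ) : ℝ) - ((2 : ℝ) ^ k)⁻¹ ↔
      (d.1 + 1) * (q.2.2 + 1) * 2 ^ k + q.2.1 * 2 ^ k * 2 ^ d.2 + (q.2.2 + 1) * 2 ^ d.2 <
        q.1 * 2 ^ k * 2 ^ d.2 := by
  rw [← Nat.cast_lt (α := ℝ)]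
  push_cast [RatCode.val, DyadicCode.val]
  have h1 : (0 : ℝ) < 2 ^ k := by positivity
  have h2 : (0 : ℝ) < 2 ^ d.2 := by positivity
  have h3 : (0 : ℝ) < (q.2.2 : ℝ) + 1 := by positivity
  rw [← one_div, div_sub_div _ _ h3.ne' h1.ne', div_lt_div_iff₀ h2 (by positivity)]
  constructor <;> intro h <;> nlinarith

section

open Primrec

theorem primrec_val_add_lt : PrimrecPred fun x : RatCode × ℕ × DyadicCode =>
    x.1.1 * 2 ^ x.2.1 * 2 ^ x.2.2.2 + (x.1.2.2 + 1) * 2 ^ x.2.2.2 <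
      (x.2.2.1 + 1) * (x.1.2.2 + 1) * 2 ^ x.2.1 + x.1.2.1 * 2 ^ x.2.1 * 2 ^ x.2.2.2 := by
  have a : Primrec fun x : RatCode × ℕ × DyadicCode => x.1.1 := fst.comp fst
  have b : Primrec fun x : RatCode × ℕ × DyadicCode => x.1.2.1 := fst.comp (snd.comp fst)
  have c : Primrec fun x : RatCode × ℕ × DyadicCode => x.1.2.2 + 1 :=
    succ.comp (snd.comp (snd.comp fst))
  have k : Primrec fun x : RatCode × ℕ × DyadicCode => 2 ^ x.2.1 :=
    nat_two_pow.comp (fst.comp snd)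
  have m : Primrec fun x : RatCode × ℕ × DyadicCode => x.2.2.1 + 1 :=
    succ.comp (fst.comp (snd.comp snd))
  have j : Primrec fun x : RatCode × ℕ × DyadicCode => 2 ^ x.2.2.2 :=
    nat_two_pow.comp (snd.comp (snd.comp snd))
  exact nat_lt.comp (nat_add.comp (nat_mul.comp (nat_mul.comp a k) j) (nat_mul.comp c j))
    (nat_add.comp (nat_mul.comp (nat_mul.comp m c) k) (nat_mul.comp (nat_mul.comp b k) j))

theorem primrec_lt_val_sub : PrimrecPred fun x : RatCode × ℕ × DyadicCode =>
    (x.2.2.1 + 1) * (x.1.2.2 + 1) * 2 ^ x.2.1 + x.1.2.1 * 2 ^ x.2.1 * 2 ^ x.2.2.2 +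
      (x.1.2.2 + 1) * 2 ^ x.2.2.2 < x.1.1 * 2 ^ x.2.1 * 2 ^ x.2.2.2 := by
  have a : Primrec fun x : RatCode × ℕ × DyadicCode => x.1.1 := fst.comp fst
  have b : Primrec fun x : RatCode × ℕ × DyadicCode => x.1.2.1 := fst.comp (snd.comp fst)
  have c : Primrec fun x : RatCode × ℕ × DyadicCode => x.1.2.2 + 1 :=
    succ.comp (snd.comp (snd.comp fst))
  have k : Primrec fun x : RatCode × ℕ × DyadicCode => 2 ^ x.2.1 :=
    nat_two_pow.comp (fst.comp snd)
  have m : Primrec fun x : RatCode × ℕ × DyadicCode => x.2.2.1 + 1 :=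
    succ.comp (fst.comp (snd.comp snd))
  have j : Primrec fun x : RatCode × ℕ × DyadicCode => 2 ^ x.2.2.2 :=
    nat_two_pow.comp (snd.comp (snd.comp snd))
  exact nat_lt.comp (nat_add.comp (nat_add.comp (nat_mul.comp (nat_mul.comp m c) k)
    (nat_mul.comp (nat_mul.comp b k) j)) (nat_mul.comp c j))
    (nat_mul.comp (nat_mul.comp a k) j)

end

theorem exists_inv_two_pow_lt {ε : ℝ} (hε : 0 < ε) : ∃ k : ℕ, 2 * ((2 : ℝ) ^ k)⁻¹ < ε := by
  obtain ⟨k, hk⟩ := exists_pow_lt_of_lt_one (half_pos hε) (by norm_num : (2⁻¹ : ℝ) < 1)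
  exact ⟨k, by rw [← inv_pow]; linarith⟩

/-- The strict upper dyadic bounds of a computable function are recursively enumerable. -/
theorem rePred_lt_dyadic_of_computable
    {N : α → ℝ} {f : α × ℕ → RatCode} (hf : Computable f)
    (hfN : ∀ a k, |N a - ((RatCode.val (f (a, k)) : ℚ) : ℝ)| < ((2 : ℝ) ^ k)⁻¹) :
    REPred fun b : α × DyadicCode => N b.1 < DyadicCode.val b.2 := by
  classical
  have harg : Computable fun x : (α × DyadicCode) × ℕ => (f (x.1.1, x.2), x.2, x.1.2) :=
    (hf.comp ((Computable.fst.comp Computable.fst).pair Computable.snd)).pair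
      (Computable.snd.pair (Computable.snd.comp Computable.fst))
  refine REPred.of_exists_computable _ (primrec_val_add_lt.decide.to_comp.comp harg)
    fun b => ?_
  simp only [decide_eq_true_eq, ← RatCode.val_add_lt_dyadicCode_val]
  constructor
  · intro h
    -- The precision is paid twice: once for the error of the approximation and once for the margin
    -- in the test.
    obtain ⟨k, hk⟩ := exists_inv_two_pow_lt (sub_pos.2 h)
    exact ⟨k, by linarith [(abs_lt.1 (hfN b.1 k)).1]⟩
  · rintro ⟨k, hk⟩
    linarith [(abs_lt.1 (hfN b.1 k)).2]

/-- The strict lower dyadic bounds of a computable function are recursively enumerable. -/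
theorem rePred_dyadic_lt_of_computable
    {N : α → ℝ} {f : α × ℕ → RatCode} (hf : Computable f)
    (hfN : ∀ a k, |N a - ((RatCode.val (f (a, k)) : ℚ) : ℝ)| < ((2 : ℝ) ^ k)⁻¹) :
    REPred fun b : α × DyadicCode => DyadicCode.val b.2 < N b.1 := by
  classical
  have harg : Computable fun x : (α × DyadicCode) × ℕ => (f (x.1.1, x.2), x.2, x.1.2) :=
    (hf.comp ((Computable.fst.comp Computable.fst).pair Computable.snd)).pair
      (Computable.snd.pair (Computable.snd.comp Computable.fst))
  refine REPred.of_exists_computable _ (primrec_lt_val_sub.decide.to_comp.comp harg)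
    fun b => ?_
  simp only [decide_eq_true_eq, ← RatCode.dyadicCode_val_lt_val_sub]
  constructor
  · intro h
    obtain ⟨k, hk⟩ := exists_inv_two_pow_lt (sub_pos.2 h)
    exact ⟨k, by linarith [(abs_lt.1 (hfN b.1 k)).2]⟩
  · rintro ⟨k, hk⟩
    linarith [(abs_lt.1 (hfN b.1 k)).1]

/-- A nonnegative function whose strict dyadic bounds on both sides are recursively enumerable is
computable. -/
theorem exists_computable_of_rePred_dyadic {N : α → ℝ} (hN : ∀ a, 0 ≤ N a)
    (hU : REPred fun b : α × DyadicCode => N b.1 < DyadicCode.val b.2)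
    (hL : REPred fun b : α × DyadicCode => DyadicCode.val b.2 < N b.1) :
    ∃ f : α × ℕ → RatCode, Computable f ∧
      ∀ a k, |N a - ((RatCode.val (f (a, k)) : ℚ) : ℝ)| < ((2 : ℝ) ^ k)⁻¹ := by
  obtain ⟨u, hu, hu'⟩ := hU.exists_computable
  obtain ⟨l, hl, hl'⟩ := hL.exists_computable
  -- `n` codes `(m, s, t)`: approximation `m / 2 ^ (k + 1)` and two search bounds
  let P : α × ℕ → ℕ → Bool := fun x n =>
    -- A dyadic code `(j, k)` names `(j + 1) / 2 ^ k`, so these tests certify `m / 2 ^ (k + 1) < N <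
    -- (m + 2) / 2 ^ (k + 1)`. Zero has no dyadic code, so for `m = 0` the lower test is waived;
    -- nonnegativity of `N` replaces it.
    u ((x.1, (n.unpair.1 + 1, x.2 + 1)), n.unpair.2.unpair.1) &&
      (decide (n.unpair.1 = 0) || l ((x.1, (n.unpair.1 - 1, x.2 + 1)), n.unpair.2.unpair.2))
  have hP : Computable fun y : (α × ℕ) × ℕ => P y.1 y.2 := by
    have hm : Computable fun y : (α × ℕ) × ℕ => y.2.unpair.1 :=
      (Primrec.fst.comp Primrec.unpair).to_comp.comp Computable.snd
    have hst : Computable fun y : (α × ℕ) × ℕ => y.2.unpair.2.unpair :=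
      (Primrec.unpair.comp (Primrec.snd.comp Primrec.unpair)).to_comp.comp Computable.snd
    have ha : Computable fun y : (α × ℕ) × ℕ => y.1.1 := Computable.fst.comp Computable.fst
    have hk : Computable fun y : (α × ℕ) × ℕ => y.1.2 + 1 :=
      Computable.succ.comp (Computable.snd.comp Computable.fst)
    have h0 : Computable fun y : (α × ℕ) × ℕ => decide (y.2.unpair.1 = 0) :=
      (Primrec.eq.comp (Primrec.id (α := ℕ)) (Primrec.const 0)).decide.to_comp.comp hm
    exact Primrec.and.to_comp.comp
      (hu.comp ((ha.pair ((Computable.succ.comp hm).pair hk)).pair (Computable.fst.comp hst)))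
      (Primrec.or.to_comp.comp h0
        (hl.comp ((ha.pair ((Computable.pred.comp hm).pair hk)).pair (Computable.snd.comp hst))))
  have hspec : ∀ x m, (∃ s, P x (Nat.pair m s) = true) ↔
      N x.1 < ((m : ℝ) + 2) / 2 ^ (x.2 + 1) ∧ (m = 0 ∨ (m : ℝ) / 2 ^ (x.2 + 1) < N x.1) := by
    intro x m
    have e1 : N x.1 < ((m : ℝ) + 2) / 2 ^ (x.2 + 1) ↔
        ∃ s, u ((x.1, (m + 1, x.2 + 1)), s) = true := by
      rw [← hu']
      simp only [DyadicCode.val]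
      push_cast
      rw [add_assoc, one_add_one_eq_two]
    have e2 : (m = 0 ∨ (m : ℝ) / 2 ^ (x.2 + 1) < N x.1) ↔
        ∃ t, (decide (m = 0) || l ((x.1, (m - 1, x.2 + 1)), t)) = true := by
      rcases m with _ | m
      · simp
      · simpa [DyadicCode.val] using hl' (x.1, (m, x.2 + 1))
    rw [e1, e2]
    constructor
    · rintro ⟨s, hs⟩
      simp only [P, Nat.unpair_pair, Bool.and_eq_true] at hs
      exact ⟨⟨_, hs.1⟩, ⟨_, hs.2⟩⟩
    · rintro ⟨⟨s, hs⟩, ⟨t, ht⟩⟩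
      exact ⟨Nat.pair s t, by simp only [P, Nat.unpair_pair, Bool.and_eq_true]; exact ⟨hs, ht⟩⟩
  have hex : ∀ x, ∃ n, P x n = true := by
    intro x
    suffices h : ∃ m : ℕ, N x.1 < ((m : ℝ) + 2) / 2 ^ (x.2 + 1) ∧
        (m = 0 ∨ (m : ℝ) / 2 ^ (x.2 + 1) < N x.1) by
      obtain ⟨m, hm⟩ := h
      obtain ⟨s, hs⟩ := (hspec x m).2 hm
      exact ⟨_, hs⟩
    have h2 : (0 : ℝ) < 2 ^ (x.2 + 1) := by positivity
    -- For `N > 0` this is the largest integer strictly below `N * 2 ^ (k + 1)`; for `N = 0`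
    -- truncated subtraction gives `0`. The window of width two makes the strict upper bound hold as
    -- well.
    refine ⟨⌈N x.1 * 2 ^ (x.2 + 1)⌉₊ - 1, ?_, ?_⟩
    · rw [lt_div_iff₀ h2]
      have h3 := Nat.le_ceil (N x.1 * 2 ^ (x.2 + 1))
      have h4 : ((⌈N x.1 * 2 ^ (x.2 + 1)⌉₊ : ℕ) : ℝ) ≤
          ((⌈N x.1 * 2 ^ (x.2 + 1)⌉₊ - 1 : ℕ) : ℝ) + 1 := by
        exact_mod_cast (by omega)
      linarith
    · rw [div_lt_iff₀ h2]
      rcases Nat.eq_zero_or_pos ⌈N x.1 * 2 ^ (x.2 + 1)⌉₊ with h | h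
      · left; omega
      · right
        exact Nat.lt_ceil.1 (by omega)
  have hfind : Computable fun x => Nat.find (hex x) :=
    Computable.find (P := fun x n => P x n = true)
      (Computable.computablePred (by simpa using hP)) hex
  -- A rational code stores its denominator minus one.
  refine ⟨fun x => ((Nat.find (hex x)).unpair.1, 0, 2 ^ (x.2 + 1) - 1), ?_, fun a k => ?_⟩
  · exact ((Primrec.fst.comp Primrec.unpair).to_comp.comp hfind).pair
      ((Computable.const 0).pair (Computable.pred.comp
        (Primrec.nat_two_pow.to_comp.comp (Computable.succ.comp Computable.snd))))
  · have h := Nat.find_spec (hex (a, k))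
    rw [← Nat.pair_unpair (Nat.find (hex (a, k)))] at h
    obtain ⟨h1, h2⟩ := (hspec (a, k) _).1 ⟨_, h⟩
    set m := (Nat.find (hex (a, k))).unpair.1
    have e : ((RatCode.val (m, 0, 2 ^ (k + 1) - 1) : ℚ) : ℝ) = (m : ℝ) / 2 ^ (k + 1) := by
      simp [RatCode.val]
    have e2 : ((m : ℝ) + 2) / 2 ^ (k + 1) = (m : ℝ) / 2 ^ (k + 1) + ((2 : ℝ) ^ k)⁻¹ := by
      rw [add_div, pow_succ]; field_simp
    have e3 : (0 : ℝ) < ((2 : ℝ) ^ k)⁻¹ := by positivity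
    simp only at h1 h2
    rw [e, abs_lt]
    refine ⟨?_, by linarith⟩
    rcases h2 with h2 | h2
    · rw [h2]; simp only [Nat.cast_zero, zero_div]; linarith [hN a]
    · linarith

end Computability

/-! ### Lifting elements along `*`-homomorphisms without increasing the norm -/

/-- Real coefficients are fixed by conjugation. This is what turns `‖x p(x* x)‖ ^ 2` into the norm
of a real polynomial in `x* x`. -/
theorem IsSelfAdjoint.aeval_map_real {𝕜 : Type*} [RCLike 𝕜] {H : Type*} [NormedAddCommGroup H]
    [InnerProductSpace 𝕜 H] [CompleteSpace H] {T : H →L[𝕜] H} (hT : IsSelfAdjoint T)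
    (p : Polynomial ℝ) : IsSelfAdjoint (Polynomial.aeval T (p.map (algebraMap ℝ 𝕜))) := by
  induction p using Polynomial.induction_on' with
  | add p q hp hq => simpa only [Polynomial.map_add, map_add] using hp.add hq
  | monomial n a =>
    rw [Polynomial.map_monomial, Polynomial.aeval_monomial, ← Algebra.smul_def]
    refine IsSelfAdjoint.smul ?_ (hT.pow n)
    simp [IsSelfAdjoint]

/-- The function `min 1 (r / √|t|)`, for `r > 0`. -/
noncomputable def cutoff (r t : ℝ) : ℝ := r / max r √|t|

theorem continuous_cutoff {r : ℝ} (hr : 0 < r) : Continuous (cutoff r) :=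
  continuous_const.div (by fun_prop) fun _ => (lt_max_of_lt_left hr).ne'

/-- Makes the cutoff invisible after applying `ψ`, where `‖ψ (x* x)‖ = r ^ 2`. -/
theorem cutoff_eq_one {r t : ℝ} (hr : 0 < r) (ht : |t| ≤ r ^ 2) : cutoff r t = 1 := by
  rw [cutoff, max_eq_left (Real.sqrt_le_left hr.le |>.2 ht), div_self hr.ne']

theorem cutoff_nonneg {r t : ℝ} (hr : 0 < r) : 0 ≤ cutoff r t :=
  div_nonneg hr.le (hr.le.trans (le_max_left _ _))

/-- Makes the norm of the lift at most `r`: by the C⋆-identity, `‖x f(x* x)‖ ^ 2` is bounded by the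
supremum of `|t| f(t) ^ 2`. -/
theorem sqrt_mul_cutoff_le {r t : ℝ} (hr : 0 < r) : √|t| * cutoff r t ≤ r := by
  rw [cutoff, mul_div_assoc', div_le_iff₀ (lt_max_of_lt_left hr), mul_comm]
  exact mul_le_mul_of_nonneg_left (le_max_right _ _) hr.le

section Lifting

variable {𝕜 : Type*} [RCLike 𝕜] {X : Type*} [NonUnitalNormedRing X] [StarRing X]
  [NormedSpace 𝕜 X]
  {H : Type*} [NormedAddCommGroup H] [InnerProductSpace 𝕜 H] [CompleteSpace H]
  {H' : Type*} [NormedAddCommGroup H'] [InnerProductSpace 𝕜 H'] [CompleteSpace H']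

/-- Elements of the form `x * p(star x * x)` exist compatibly in two representations. -/
theorem exists_map_eq_mul_aeval (φ : X →⋆ₙₐ[𝕜] (H →L[𝕜] H)) (ψ : X →⋆ₙₐ[𝕜] (H' →L[𝕜] H')) (x b : X)
    (p : Polynomial 𝕜) : ∃ c : X, φ c = φ x * Polynomial.aeval (φ b) p ∧
      ψ c = ψ x * Polynomial.aeval (ψ b) p := by
  induction p using Polynomial.induction_on with
  | C a =>
    -- The left factor `x` absorbs the constant term, so the element exists although `X` need not
    -- have a unit.
    refine ⟨a • x, ?_, ?_⟩ <;>
      rw [map_smul, Polynomial.aeval_C, Algebra.algebraMap_eq_smul_one, mul_smul_comm, mul_one]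
  | add p q hp hq =>
    obtain ⟨c, hc, hc'⟩ := hp
    obtain ⟨d, hd, hd'⟩ := hq
    exact ⟨c + d, by rw [map_add, map_add, mul_add, hc, hd],
      by rw [map_add, map_add, mul_add, hc', hd']⟩
  | monomial n a h =>
    obtain ⟨c, hc, hc'⟩ := h
    refine ⟨c * b, ?_, ?_⟩ <;>
      rw [map_mul, pow_succ, ← mul_assoc (Polynomial.C a), map_mul (Polynomial.aeval _), ← mul_assoc,
        Polynomial.aeval_X]
    · rw [hc]
    · rw [hc']

/-- Every element of the image of a `*`-homomorphism of C⋆-algebras lifts to an element of at most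
the same norm. -/
theorem exists_norm_le_map_eq [IsScalarTower 𝕜 X X] [SMulCommClass 𝕜 X X] [StarModule 𝕜 X]
    [NormedStarGroup X] [CompleteSpace X] (φ : X →⋆ₙₐ[𝕜] (H →L[𝕜] H))
    (hφ : Isometry φ) (ψ : X →⋆ₙₐ[𝕜] (H' →L[𝕜] H')) (x : X) : ∃ c : X, ‖c‖ ≤ ‖ψ x‖ ∧ ψ c = ψ x := by
  have hnorm : ∀ y : X, ‖φ y‖ = ‖y‖ := (AddMonoidHomClass.isometry_iff_norm φ).1 hφ
  rcases (norm_nonneg (ψ x)).eq_or_lt with hr | hr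
  -- The cutoff needs `r > 0`; for `r = 0` the lift is zero.
  · exact ⟨0, by simp, by rw [map_zero]; exact (norm_eq_zero.1 hr.symm).symm⟩
  set r := ‖ψ x‖
  obtain ⟨b, hb⟩ : ∃ b, b = star x * x := ⟨_, rfl⟩
  set M := ‖b‖
  have hT : IsSelfAdjoint (φ b) := by rw [hb, map_mul, map_star]; exact IsSelfAdjoint.star_mul_self _
  have hT' : IsSelfAdjoint (ψ b) := by
    rw [hb, map_mul, map_star]; exact IsSelfAdjoint.star_mul_self _
  have hTM : ‖φ b‖ ≤ M := (hnorm b).le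
  have hTr : ‖ψ b‖ = r ^ 2 := by
    rw [hb, map_mul, map_star, sq]; exact CStarRing.norm_star_mul_self
  have hrM : r ^ 2 ≤ M := hTr ▸ norm_starHom_le ψ b
  have hε : ∀ n : ℕ, (0 : ℝ) < 1 / ((n : ℝ) + 1) := fun n => by positivity
  -- Weierstrass approximation of the cutoff on `[-M, M]`, within `1 / (n + 1)`. The elements `c n`,
  -- which play the role of `x * p n (x* x)`, will form a Cauchy sequence whose limit is the desired
  -- lift.
  choose p hp using fun n : ℕ => exists_polynomial_near_of_continuousOn (-M) M (cutoff r)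
    (continuous_cutoff hr).continuousOn _ (hε n)
  choose c hc hc' using fun n : ℕ =>
    exists_map_eq_mul_aeval φ ψ x b ((p n).map (algebraMap ℝ 𝕜))
  have hdiff : ∀ n m : ℕ, dist (c n) (c m) ≤
      ‖x‖ * (1 / ((n : ℝ) + 1) + 1 / ((m : ℝ) + 1)) := fun n m => by
    rw [dist_eq_norm, ← hnorm, map_sub, hc, hc, ← mul_sub, ← map_sub, ← Polynomial.map_sub]
    refine (norm_mul_le _ _).trans ?_
    rw [hnorm]
    refine mul_le_mul_of_nonneg_left (hT.norm_aeval_le hTM _ fun t ht => ?_) (norm_nonneg x)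
    rw [Polynomial.eval_sub]
    have h1 := abs_lt.1 (hp n t ht)
    have h2 := abs_lt.1 (hp m t ht)
    rw [abs_le]
    constructor <;> linarith
  have hε0 : Filter.Tendsto (fun n : ℕ => 1 / ((n : ℝ) + 1)) Filter.atTop (nhds 0) :=
    tendsto_one_div_add_atTop_nhds_zero_nat
  have hcauchy : CauchySeq c := by
    refine cauchySeq_of_le_tendsto_0 (fun n => ‖x‖ * (1 / ((n : ℝ) + 1) + 1 / ((n : ℝ) + 1)))
      (fun n m k hn hm => (hdiff n m).trans ?_) (by simpa using (hε0.add hε0).const_mul ‖x‖)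
    gcongr
  obtain ⟨d, hd⟩ := cauchySeq_tendsto_of_complete hcauchy
  have hcn : ∀ n, ‖c n‖ ≤ r + √M * (1 / ((n : ℝ) + 1)) := fun n => by
    refine le_of_sq_le_sq ?_ (by positivity)
    set q := p n
    have hQ := hT.aeval_map_real q
    -- The C⋆-identity gives `‖c n‖ ^ 2 = ‖q(b) b q(b)‖` with `b = x* x`. The polynomial bound
    -- ranges over a symmetric interval, without using positivity of `b`, which is why the cutoff is
    -- defined with `|t|`.
    have e : ‖c n‖ ^ 2 =
        ‖Polynomial.aeval (φ b) ((q * Polynomial.X * q).map (algebraMap ℝ 𝕜))‖ := by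
      rw [← hnorm, sq, ← CStarRing.norm_star_mul_self, hc, star_mul, hQ.star_eq, mul_assoc,
        ← mul_assoc (star (φ x)), ← map_star, ← map_mul, ← hb, Polynomial.map_mul,
        Polynomial.map_mul, Polynomial.map_X, map_mul, map_mul, Polynomial.aeval_X, mul_assoc]
    rw [e]
    refine hT.norm_aeval_le hTM _ fun t ht => ?_
    rw [Polynomial.eval_mul, Polynomial.eval_mul, Polynomial.eval_X, abs_mul, abs_mul]
    have h1 : |q.eval t| ≤ cutoff r t + 1 / ((n : ℝ) + 1) := by
      have h := abs_lt.1 (hp n t ht)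
      rw [abs_le]
      constructor <;> linarith [cutoff_nonneg (t := t) hr]
    have h2 : √|t| * |q.eval t| ≤ r + √M * (1 / ((n : ℝ) + 1)) := by
      refine (mul_le_mul_of_nonneg_left h1 (Real.sqrt_nonneg _)).trans ?_
      rw [mul_add]
      have h3 : √|t| ≤ √M := Real.sqrt_le_sqrt (abs_le.2 ht)
      exact add_le_add (sqrt_mul_cutoff_le hr) (mul_le_mul_of_nonneg_right h3 (hε n).le)
    calc |q.eval t| * |t| * |q.eval t| = (√|t| * |q.eval t|) ^ 2 := by
          rw [mul_pow, Real.sq_sqrt (abs_nonneg t)]; ring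
      _ ≤ _ := by gcongr
  have hψn : ∀ n, ‖ψ (c n) - ψ x‖ ≤ r * (1 / ((n : ℝ) + 1)) := fun n => by
    have e : ψ (c n) - ψ x =
        ψ x * Polynomial.aeval (ψ b) ((p n - 1).map (algebraMap ℝ 𝕜)) := by
      rw [hc', Polynomial.map_sub, Polynomial.map_one, map_sub, map_one, mul_sub, mul_one]
    rw [e]
    refine (norm_mul_le _ _).trans (mul_le_mul_of_nonneg_left
      (hT'.norm_aeval_le hTr.le _ fun t ht => ?_) hr.le)
    -- The approximation is available on `[-r ^ 2, r ^ 2]` because `r ^ 2 ≤ M`, that is, because `ψ`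
    -- is contractive.
    have h := hp n t ⟨by linarith [ht.1], by linarith [ht.2]⟩
    rw [cutoff_eq_one hr (abs_le.2 ht)] at h
    simpa using h.le
  have hψ : Continuous ψ := AddMonoidHomClass.continuous_of_bound ψ 1 fun y => by
    rw [one_mul]; exact norm_starHom_le ψ y
  refine ⟨d, ?_, ?_⟩
  · refine le_of_tendsto_of_tendsto' hd.norm ?_ hcn
    simpa using (hε0.const_mul √M).const_add r
  · refine tendsto_nhds_unique ((hψ.tendsto d).comp hd) ?_
    rw [tendsto_iff_norm_sub_tendsto_zero]
    exact squeeze_zero (fun _ => norm_nonneg _) hψn (by simpa using hε0.const_mul r)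

end Lifting

/-! ### The word problem -/

section Eval

variable {𝕜 : Type*} [RCLike 𝕜] {ι : Type} {A B : Type*} [NonUnitalNormedRing A] [StarRing A]
  [NormedSpace 𝕜 A] [NonUnitalNormedRing B] [StarRing B] [NormedSpace 𝕜 B]

theorem WordCode.map_eval (π : A →⋆ₙₐ[𝕜] B) (a : ι → A) (w : WordCode ι) :
    π (WordCode.eval a w) = WordCode.eval (fun i => π (a i)) w := by
  have hl : ∀ l : LetterCode ι, π (l.eval a) = l.eval fun i => π (a i) := fun l => by
    unfold LetterCode.eval; split_ifs <;> simp [map_star]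
  have hw : ∀ (l : List (LetterCode ι)) (y : A),
      π (l.foldl (fun x l => x * LetterCode.eval a l) y) =
        l.foldl (fun x l => x * LetterCode.eval (fun i => π (a i)) l) (π y) := fun l => by
    induction l with
    | nil => intro y; rfl
    | cons m l ih => intro y; rw [List.foldl_cons, ih, map_mul, hl, List.foldl_cons]
  rw [WordCode.eval, hw, hl, WordCode.eval]

theorem PolyCode.map_eval (π : A →⋆ₙₐ[𝕜] B) (a : ι → A) (p : PolyCode ι) :
    π (PolyCode.eval 𝕜 a p) = PolyCode.eval 𝕜 (fun i => π (a i)) p := by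
  rw [PolyCode.eval, PolyCode.eval, map_list_sum, List.map_map]
  congr 2
  funext m
  rw [Function.comp_apply, map_smul, WordCode.map_eval]

end Eval

/-! ### The distance to the kernel. -/

namespace UniversalContraction

variable {𝕜 : Type} [RCLike 𝕜] {ι : Type} {A : Type u} [NonUnitalNormedRing A] [StarRing A]
  [NormedSpace 𝕜 A] [IsScalarTower 𝕜 A A] [SMulCommClass 𝕜 A A] [StarModule 𝕜 A]
  [CStarAlgebraOver 𝕜 A] (π : UniversalContraction.{u} 𝕜 ι →⋆ₙₐ[𝕜] A)

theorem norm_hom_le (x : UniversalContraction.{u} 𝕜 ι) : ‖π x‖ ≤ ‖x‖ := by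
  obtain ⟨H, _, _, _, φ, hφ⟩ := CStarAlgebraOver.exists_isometric_rep (𝕜 := 𝕜) (A := A)
  rw [← (AddMonoidHomClass.isometry_iff_norm φ).1 hφ]
  exact norm_starHom_le (φ.comp π) x

theorem continuous_hom : Continuous π :=
  AddMonoidHomClass.continuous_of_bound π 1 fun x => by rw [one_mul]; exact norm_hom_le π x

/-- Subtracting such a `c` from `x` gives a point of the kernel nearest to `x`. -/
theorem exists_norm_le_hom_eq (x : UniversalContraction.{u} 𝕜 ι) : ∃ c, ‖c‖ ≤ ‖π x‖ ∧ π c = π x := by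
  obtain ⟨H, _, _, _, φ, hφ⟩ :=
    CStarAlgebraOver.exists_isometric_rep (𝕜 := 𝕜) (A := UniversalContraction.{u} 𝕜 ι)
  obtain ⟨H', _, _, _, φ', hφ'⟩ := CStarAlgebraOver.exists_isometric_rep (𝕜 := 𝕜) (A := A)
  obtain ⟨c, hc, hc'⟩ := exists_norm_le_map_eq φ hφ (φ'.comp π) x
  exact ⟨c, hc.trans_eq ((AddMonoidHomClass.isometry_iff_norm φ').1 hφ' _), hφ'.injective hc'⟩

theorem ball_inter_ker_nonempty_iff (x : UniversalContraction.{u} 𝕜 ι) (r : ℝ) :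
    (Metric.ball x r ∩ {y | π y = 0}).Nonempty ↔ ‖π x‖ < r := by
  constructor
  · rintro ⟨y, hy, hy0 : π y = 0⟩
    rw [Metric.mem_ball', dist_eq_norm] at hy
    refine lt_of_le_of_lt ?_ hy
    simpa [hy0] using norm_hom_le π (x - y)
  · intro h
    obtain ⟨c, hc, hc'⟩ := exists_norm_le_hom_eq π x
    exact ⟨x - c, by rw [Metric.mem_ball', dist_eq_norm, sub_sub_cancel]; exact hc.trans_lt h,
      by simp [hc']⟩

/-- Here attainment is essential: a lift of norm at most `‖π x‖ + ε` would suffice for open balls,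
but not for a closed ball of radius exactly `‖π x‖`. -/
theorem closedBall_inter_ker_eq_empty_iff (x : UniversalContraction.{u} 𝕜 ι) (r : ℝ) :
    Metric.closedBall x r ∩ {y | π y = 0} = ∅ ↔ r < ‖π x‖ := by
  rw [← not_iff_not, ← ne_eq, ← Set.nonempty_iff_ne_empty, not_lt]
  constructor
  · rintro ⟨y, hy, hy0 : π y = 0⟩
    rw [Metric.mem_closedBall', dist_eq_norm] at hy
    refine le_trans ?_ hy
    simpa [hy0] using norm_hom_le π (x - y)
  · intro h
    obtain ⟨c, hc, hc'⟩ := exists_norm_le_hom_eq π x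
    exact ⟨x - c, by rw [Metric.mem_closedBall', dist_eq_norm, sub_sub_cancel]; exact hc.trans h,
      by simp [hc']⟩

end UniversalContraction

theorem mainTheorem7 {𝕜 : Type} [RCLike 𝕜] {A : Type u} [NonUnitalNormedRing A] [StarRing A]
    [NormedSpace 𝕜 A] [IsScalarTower 𝕜 A A] [SMulCommClass 𝕜 A A] [StarModule 𝕜 A]
    [CStarAlgebraOver 𝕜 A] (P : CStarPresentation 𝕜 A) (hP : ∀ j, ‖P.point j‖ ≤ 1) :
    P.IsComputable ↔
      (UniversalContraction.standardPresentation.{u} 𝕜 P.length).IsStronglyComputableClosed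
        (P.wordProblem hP) := by
  set π := UniversalContraction.lift.{u} (𝕜 := 𝕜) P.point hP with hπ
  have hcl : IsClosed (P.wordProblem hP) :=
    isClosed_singleton.preimage (UniversalContraction.continuous_hom π)
  -- Evaluation of `*`-polynomials commutes with `π`, so no translation between codes is needed.
  have hpt : ∀ p : PolyCode (SeqIndex P.length),
      π ((UniversalContraction.standardPresentation.{u} 𝕜 P.length).ratPoint p) = P.ratPoint p :=
    fun p => by
      refine (PolyCode.map_eval π _ p).trans ?_
      exact congrArg (fun a => PolyCode.eval 𝕜 a p)
        (funext fun i => UniversalContraction.lift_gen P.point hP i)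
  have hU : ∀ b : PolyCode (SeqIndex P.length) × DyadicCode,
      (Metric.ball ((UniversalContraction.standardPresentation.{u} 𝕜 P.length).ratPoint b.1)
        (DyadicCode.val b.2) ∩ P.wordProblem hP).Nonempty ↔
          ‖P.ratPoint b.1‖ < DyadicCode.val b.2 := fun b => by
    rw [← hpt]; exact UniversalContraction.ball_inter_ker_nonempty_iff π _ _
  have hL : ∀ b : PolyCode (SeqIndex P.length) × DyadicCode,
      Metric.closedBall ((UniversalContraction.standardPresentation.{u} 𝕜 P.length).ratPoint b.1)
        (DyadicCode.val b.2) ∩ P.wordProblem hP = ∅ ↔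
          DyadicCode.val b.2 < ‖P.ratPoint b.1‖ := fun b => by
    rw [← hpt]; exact UniversalContraction.closedBall_inter_ker_eq_empty_iff π _ _
  constructor
  · rintro ⟨f, hf, hfN⟩
    exact ⟨⟨hcl, (rePred_lt_dyadic_of_computable hf hfN).of_eq fun b => (hU b).symm⟩,
      ⟨hcl, (rePred_dyadic_lt_of_computable hf hfN).of_eq fun b => (hL b).symm⟩⟩
  · rintro ⟨⟨-, h1⟩, ⟨-, h2⟩⟩
    exact exists_computable_of_rePred_dyadic (fun p => norm_nonneg (P.ratPoint p))
      (h1.of_eq hU) (h2.of_eq hL)
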